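/- Let $\tau$ be an infinite cardinal, let $B(\tau)$ be the generalized Baire space of weight $\tau$, that is, the product of countably many copies of the discrete space of cardinality $\tau$, and let $Q^\infty=[0,1]^{\mathbb N}$ be the Hilbert cube. A finite-component covering of a space is a star-finite open covering (every element meets only finitely many elements) all of whose components are finite, where the components of a system of sets are its maximal subsystems in which any two elements $M,M'$ are joined by a finite chain $M=M_0,\dots,M_s=M'$ of elements of the subsystem with $M_{i-1}\cap M_i\neq\emptyset$ for $i=1,\dots,s$. A space is superparacompact if every open covering of it is refined by a finite-component covering. The weight of a space is the least cardinality of a base of its topology, and a perfect map is a continuous closed map with compact fibres (not necessarily surjective). For every metrizable space $X$ the following statements are equivalent: (a) $X$ is superparacompact, completely metrizable, and of weight $\le\tau$; (b) there is a perfect map from $X$ into $B(\tau)$; (c) $X$ is homeomorphic to a closed subspace of $B(\tau)\times Q^\infty$. -/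

import Mathlib

open Topology TopologicalSpace Set
open scoped Cardinal

universe u

/-- A system `ω` of sets is star-finite if every element of `ω` meets only finitely many
elements of `ω`. -/
def IsStarFinite {X : Type u} (ω : Set (Set X)) : Prop :=
  ∀ U ∈ ω, {V ∈ ω | (U ∩ V).Nonempty}.Finite

/-- `M` and `M'` are connected by a chain `M = c 0, c 1, …, c s = M'` of elements of `ω`
in which consecutive sets intersect. -/
def ChainConnected {X : Type u} (ω : Set (Set X)) (M M' : Set X) : Prop :=
  ∃ (s : ℕ) (c : ℕ → Set X), c 0 = M ∧ c s = M' ∧ (∀ i ≤ s, c i ∈ ω) ∧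
    ∀ i < s, (c i ∩ c (i + 1)).Nonempty

/-- A system of sets is enchained if any two of its elements are connected by a chain of its
elements. -/
def IsEnchained {X : Type u} (ω : Set (Set X)) : Prop :=
  ∀ M ∈ ω, ∀ M' ∈ ω, ChainConnected ω M M'

/-- The components (of overlapping) of a system of sets are its maximal enchained subsystems. -/
def IsOverlapComponent {X : Type u} (ω σ : Set (Set X)) : Prop :=
  Maximal (fun σ' : Set (Set X) => σ' ⊆ ω ∧ IsEnchained σ') σ

/-- `ω` is an open covering of `X`. -/
def IsOpenCovering {X : Type u} [TopologicalSpace X] (ω : Set (Set X)) : Prop :=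
  (∀ U ∈ ω, IsOpen U) ∧ ⋃₀ ω = univ

/-- A finite-component covering: a star-finite open covering all of whose components are
finite. -/
def IsFiniteComponentCovering {X : Type u} [TopologicalSpace X] (ω : Set (Set X)) : Prop :=
  IsOpenCovering ω ∧ IsStarFinite ω ∧ ∀ σ, IsOverlapComponent ω σ → σ.Finite

/-- A space is superparacompact if every open covering has a finite-component (open)
refinement. -/
def IsSuperparacompact (X : Type u) [TopologicalSpace X] : Prop :=
  ∀ ω : Set (Set X), IsOpenCovering ω →
    ∃ ω' : Set (Set X), IsFiniteComponentCovering ω' ∧ ∀ V ∈ ω', ∃ U ∈ ω, V ⊆ U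

/-- The weight of a space: the least cardinality of a base of its topology. -/
noncomputable def topWeight (X : Type u) [TopologicalSpace X] : Cardinal.{u} :=
  sInf {κ : Cardinal.{u} | ∃ B : Set (Set X), IsTopologicalBasis B ∧ #B = κ}

/-- The generalized Baire space `B(τ)`: the product of countably many copies of the discrete
space of cardinality `τ`. -/
def GenBaireSpace (τ : Cardinal.{u}) : Type u := ℕ → τ.out

instance GenBaireSpace.instTopologicalSpace (τ : Cardinal.{u}) : TopologicalSpace (GenBaireSpace τ) :=
  @Pi.topologicalSpace ℕ (fun _ => τ.out) (fun _ => ⊥)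

/-- The Hilbert cube. -/
abbrev HilbertCube : Type := ℕ → unitInterval

/-!
The three conditions are linked through maps into a power `ℕ → A` of a discrete space `A`; for
`A = τ.out` this power is `B(τ)`.

If `X` is superparacompact and completely metrizable, a finite-component covering by sets contained
in balls of radius `2⁻ⁿ` has components whose unions partition `X` into open sets. The weight
bounds the number of parts, so a locally constant map `X → A` can label them, and each of its
fibres is covered by finitely many small sets
(`IsFiniteComponentCovering.exists_isLocallyConstant`). The maps for all `n` together form
a map `X → ℕ → A`, which is perfect because the space is complete
(`exists_isProperMap_of_isSuperparacompact`).

Conversely, let `f : X → ℕ → A` be perfect. For each open covering of `X`, the space `ℕ → A`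
splits into disjoint cylinders whose preimages are finitely covered
(`IsProperMap.exists_isLocallyConstant_finite_cover`). Applied to a given covering, this shows
that `X` is superparacompact (`IsProperMap.isSuperparacompact`). Applied to coverings by small
balls, it yields countably many continuous functions `X → [0, 1]` that separate the points of each
fibre of `f`; together with `f` they form a closed embedding into `(ℕ → A) × Q^∞`
(`IsProperMap.exists_isClosedEmbedding_prod`). A closed embedding into that product gives
complete metrizability and the bound on the weight, and composed with the projection along the
compact factor it is a perfect map into `ℕ → A`.
-/

/-! ### Chains and components -/

/-- Two members of the system `ω` overlap. Chains in `ω` are the paths of this relation. -/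
def Overlap {X : Type u} (ω : Set (Set X)) (A B : Set X) : Prop :=
  A ∈ ω ∧ B ∈ ω ∧ (A ∩ B).Nonempty

theorem chainConnected_iff_reflTransGen {X : Type u} {ω : Set (Set X)} {M M' : Set X}
    (hM : M ∈ ω) : ChainConnected ω M M' ↔ Relation.ReflTransGen (Overlap ω) M M' := by
  constructor
  · rintro ⟨s, c, rfl, rfl, hc, hi⟩
    have key : ∀ i ≤ s, Relation.ReflTransGen (Overlap ω) (c 0) (c i) := by
      intro i
      induction i with
      | zero => exact fun _ => .refl
      | succ i ih =>
        intro h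
        exact (ih (by omega)).tail ⟨hc _ (by omega), hc _ h, hi _ (by omega)⟩
    exact key s le_rfl
  · intro h
    induction h with
    | refl => exact ⟨0, fun _ => M, rfl, rfl, fun _ _ => hM, fun _ h => absurd h (by omega)⟩
    | @tail B B' _ hB ih =>
      obtain ⟨s, c, h0, rfl, hc, hi⟩ := ih
      refine ⟨s + 1, fun i => if i ≤ s then c i else B', by simpa using h0, by simp, ?_, ?_⟩
      · intro i _
        by_cases h : i ≤ s
        · simpa [h] using hc i h
        · simpa [h] using hB.2.1
      · intro i hi'
        rcases Nat.lt_succ_iff_lt_or_eq.1 hi' with h | rfl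
        · simpa [h.le, Nat.succ_le_of_lt h] using hi i h
        · simpa using hB.2.2

theorem reflTransGen_overlap_symm {X : Type u} {ω : Set (Set X)} {A B : Set X}
    (h : Relation.ReflTransGen (Overlap ω) A B) : Relation.ReflTransGen (Overlap ω) B A := by
  induction h with
  | refl => exact .refl
  | tail _ hB ih => exact .head ⟨hB.2.1, hB.1, by rw [inter_comm]; exact hB.2.2⟩ ih

/-- The members reachable from `M` by chains form the component of `M`. -/
theorem isOverlapComponent_setOf_reflTransGen {X : Type u} {ω : Set (Set X)} {M : Set X}
    (hM : M ∈ ω) : IsOverlapComponent ω {B | Relation.ReflTransGen (Overlap ω) M B} := by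
  have hsub : {B | Relation.ReflTransGen (Overlap ω) M B} ⊆ ω := by
    rintro B (h : Relation.ReflTransGen _ _ _)
    cases h with
    | refl => exact hM
    | tail _ h => exact h.2.1
  -- A chain that starts at `M` stays in the set of all members reachable from `M`.
  have hin : ∀ B, Relation.ReflTransGen (Overlap ω) M B →
      Relation.ReflTransGen (Overlap {B | Relation.ReflTransGen (Overlap ω) M B}) M B := by
    intro B h
    induction h with
    | refl => exact .refl
    | tail h hB ih => exact ih.tail ⟨h, h.tail hB, hB.2.2⟩
  refine ⟨⟨hsub, fun B hB B' hB' => ?_⟩, ?_⟩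
  · rw [chainConnected_iff_reflTransGen hB]
    exact (reflTransGen_overlap_symm (hin B hB)).trans (hin B' hB')
  · rintro σ ⟨hσ, hσ'⟩ hle B hB
    have hMσ : M ∈ σ := hle Relation.ReflTransGen.refl
    exact ((chainConnected_iff_reflTransGen hMσ).1 (hσ' M hMσ B hB)).lift id
      fun _ _ h => ⟨hσ h.1, hσ h.2.1, h.2.2⟩

/-! ### From superparacompact spaces to perfect maps -/

theorem exists_isTopologicalBasis_mk_eq_topWeight (X : Type u) [TopologicalSpace X] :
    ∃ B : Set (Set X), IsTopologicalBasis B ∧ #B = topWeight X :=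
  csInf_mem (s := {κ : Cardinal.{u} | ∃ B : Set (Set X), IsTopologicalBasis B ∧ #B = κ})
    ⟨_, _, isTopologicalBasis_opens, rfl⟩

/-- The unions of the components of a finite-component covering partition the space into open
sets, and the weight bounds the number of these; so they can be labelled by elements of `A`. -/
theorem IsFiniteComponentCovering.exists_isLocallyConstant {X A : Type u} [TopologicalSpace X]
    (hA : topWeight X ≤ #A) {ω : Set (Set X)} (hω : IsFiniteComponentCovering ω) :
    ∃ f : X → A, IsLocallyConstant f ∧ ∀ a, ∃ F ⊆ ω, F.Finite ∧ f ⁻¹' {a} ⊆ ⋃₀ F := by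
  obtain ⟨⟨hopen, hcov⟩, -, hfin⟩ := hω
  have hM : ∀ x : X, ∃ M ∈ ω, x ∈ M := fun x => by
    have : x ∈ ⋃₀ ω := hcov ▸ mem_univ x
    simpa using this
  choose M hMω hxM using hM
  set K : X → Set (Set X) := fun x => {B | Relation.ReflTransGen (Overlap ω) (M x) B}
  have hcomp : ∀ x, IsOverlapComponent ω (K x) := fun x =>
    isOverlapComponent_setOf_reflTransGen (hMω x)
  have hKω : ∀ x, K x ⊆ ω := fun x => (hcomp x).prop.1
  set U : X → Set X := fun x => ⋃₀ K x with hU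
  have hUo : ∀ x, IsOpen (U x) := fun x => isOpen_sUnion fun B hB => hopen B (hKω x hB)
  have hxU : ∀ x, x ∈ U x := fun x => ⟨M x, .refl, hxM x⟩
  have hUU : ∀ x, ∀ y ∈ U x, U y = U x := by
    rintro x y ⟨B, hB, hy⟩
    have hxy : Relation.ReflTransGen (Overlap ω) (M x) (M y) :=
      Relation.ReflTransGen.tail hB ⟨hKω x hB, hMω y, y, hy, hxM y⟩
    have : K y = K x := by
      ext B'
      exact ⟨fun h => hxy.trans h, fun h => (reflTransGen_overlap_symm hxy).trans h⟩
    simp only [hU, this]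
  obtain ⟨𝓑, h𝓑, hcard⟩ := exists_isTopologicalBasis_mk_eq_topWeight X
  -- The disjoint non-empty open sets `U x` contain distinct non-empty members of a base.
  have hb : ∀ s : range U, ∃ b : 𝓑, (b : Set X).Nonempty ∧ (b : Set X) ⊆ s := by
    rintro ⟨_, x, rfl⟩
    obtain ⟨b, hb, hxb, hbU⟩ := h𝓑.exists_subset_of_mem_open (hxU x) (hUo x)
    exact ⟨⟨b, hb⟩, ⟨x, hxb⟩, hbU⟩
  choose b hbne hbs using hb
  have hbinj : Function.Injective b := by
    rintro ⟨_, x, rfl⟩ ⟨_, x', rfl⟩ h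
    obtain ⟨z, hz⟩ := hbne ⟨U x, x, rfl⟩
    have hz' : z ∈ U x' := hbs ⟨U x', x', rfl⟩ (h ▸ hz)
    exact Subtype.ext ((hUU x z (hbs _ hz)).symm.trans (hUU x' z hz'))
  have hle : #(range U) ≤ #A := (Cardinal.mk_le_of_injective hbinj).trans (hcard.trans_le hA)
  obtain ⟨e⟩ := hle
  have hfU : ∀ x y, e ⟨U y, y, rfl⟩ = e ⟨U x, x, rfl⟩ ↔ U y = U x := fun x y =>
    e.injective.eq_iff.trans Subtype.ext_iff
  refine ⟨fun x => e ⟨U x, x, rfl⟩, ?_, ?_⟩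
  · rw [IsLocallyConstant.iff_exists_open]
    exact fun x => ⟨U x, hUo x, hxU x, fun y hy => (hfU x y).2 (hUU x y hy)⟩
  · intro a
    by_cases h : ∃ x, e ⟨U x, x, rfl⟩ = a
    · obtain ⟨x, rfl⟩ := h
      refine ⟨K x, hKω x, hfin _ (hcomp x), fun y hy => ?_⟩
      have : U y = U x := (hfU x y).1 hy
      exact (this ▸ hxU y : y ∈ U x)
    · exact ⟨∅, empty_subset _, finite_empty, fun y hy => absurd ⟨y, hy⟩ h⟩

/-- Label, for every `n`, the parts of a partition coming from a covering by balls of radius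
`2⁻ⁿ`. An ultrafilter along which all labels converge contains sets of arbitrarily small
diameter, hence converges; this is properness of the map given by the labels. -/
theorem exists_isProperMap_of_isSuperparacompact {X A : Type u} [TopologicalSpace X]
    [IsCompletelyMetrizableSpace X] [TopologicalSpace A] [DiscreteTopology A]
    (hX : IsSuperparacompact X) (hA : topWeight X ≤ #A) :
    ∃ f : X → ℕ → A, IsProperMap f := by
  let := upgradeIsCompletelyMetrizable X
  have key : ∀ n : ℕ, ∃ f : X → A, IsLocallyConstant f ∧ ∀ a, ∃ F : Set (Set X), F.Finite ∧
      (∀ V ∈ F, ∃ x, V ⊆ Metric.ball x ((1 / 2) ^ n)) ∧ f ⁻¹' {a} ⊆ ⋃₀ F := by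
    intro n
    obtain ⟨ω, hω, href⟩ := hX (range fun x => Metric.ball x ((1 / 2) ^ n)) (by
      refine ⟨by rintro _ ⟨x, rfl⟩; exact Metric.isOpen_ball, eq_univ_of_forall fun x => ?_⟩
      exact ⟨_, ⟨x, rfl⟩, Metric.mem_ball_self (by positivity)⟩)
    obtain ⟨f, hf, hF⟩ := hω.exists_isLocallyConstant hA
    refine ⟨f, hf, fun a => ?_⟩
    obtain ⟨F, hFω, hFfin, hFa⟩ := hF a
    refine ⟨F, hFfin, fun V hV => ?_, hFa⟩
    obtain ⟨_, ⟨x, rfl⟩, h⟩ := href V (hFω hV)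
    exact ⟨x, h⟩
  choose f hf hF using key
  refine ⟨fun x n => f n x, isProperMap_iff_ultrafilter_of_t2.2
    ⟨continuous_pi fun n => (hf n).continuous, fun 𝒰 y hy => ?_⟩⟩
  suffices h : Cauchy (𝒰 : Filter X) from CompleteSpace.complete h
  rw [Metric.cauchy_iff]
  refine ⟨𝒰.neBot, fun ε hε => ?_⟩
  obtain ⟨n, hn⟩ := exists_pow_lt_of_lt_one (half_pos hε) (by norm_num : (1 / 2 : ℝ) < 1)
  obtain ⟨F, hFfin, hball, hsub⟩ := hF n (y n)
  have hmem : f n ⁻¹' {y n} ∈ 𝒰 := by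
    have := (tendsto_pi_nhds.1 hy) n
    rw [nhds_discrete, Filter.tendsto_pure] at this
    exact this
  obtain ⟨V, hV, hV𝒰⟩ := (Ultrafilter.finite_sUnion_mem_iff hFfin).1
    (Filter.mem_of_superset hmem hsub)
  obtain ⟨x, hx⟩ := hball V hV
  refine ⟨V, hV𝒰, fun p hp q hq => ?_⟩
  have h1 := Metric.mem_ball.1 (hx hp)
  have h2 := Metric.mem_ball.1 (hx hq)
  have h3 := dist_triangle_right p q x
  linarith

/-! ### Spaces with a perfect map into a Baire space -/

/-- A proper map into a Baire space pulls the cylinders back to sets fine enough for any open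
covering: there is a partition of the Baire space into cylinders (the shortest suitable one
around each point), encoded by the locally constant map `c` sending a point to its part, such that
the preimage of every part is covered by finitely many members of the covering. -/
theorem IsProperMap.exists_isLocallyConstant_finite_cover {X : Type*} {A : Type*}
    [TopologicalSpace X] [TopologicalSpace A] [DiscreteTopology A] {f : X → ℕ → A}
    (hf : IsProperMap f) {ω : Set (Set X)} (hopen : ∀ U ∈ ω, IsOpen U) (hcov : ⋃₀ ω = univ) :
    ∃ c : (ℕ → A) → Set (ℕ → A), IsLocallyConstant c ∧
      ∀ s, ∃ F ⊆ ω, F.Finite ∧ (c ∘ f) ⁻¹' {s} ⊆ ⋃₀ F := by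
  classical
  have hex : ∀ y : ℕ → A, ∃ n, ∃ F ⊆ ω, F.Finite ∧ f ⁻¹' PiNat.cylinder y n ⊆ ⋃₀ F := by
    intro y
    have hcomp : IsCompact (f ⁻¹' {y}) := hf.isCompact_preimage isCompact_singleton
    obtain ⟨F, hFω, hFfin, hF⟩ := hcomp.elim_finite_subcover_image (c := id) hopen
      (by simp [← sUnion_eq_biUnion, hcov])
    simp only [id, ← sUnion_eq_biUnion] at hF
    have hFo : IsOpen (⋃₀ F) := isOpen_sUnion fun U hU => hopen U (hFω hU)
    have hclosed := hf.isClosedMap _ hFo.isClosed_compl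
    have hy : y ∈ (f '' (⋃₀ F)ᶜ)ᶜ := by
      rintro ⟨x, hx, rfl⟩
      exact hx (hF rfl)
    obtain ⟨_, ⟨z, n, rfl⟩, hyz, hsub⟩ :=
      (PiNat.isTopologicalBasis_cylinders (fun _ : ℕ => A)).exists_subset_of_mem_open hy
        hclosed.isOpen_compl
    rw [PiNat.mem_cylinder_iff_eq] at hyz
    refine ⟨n, F, hFω, hFfin, fun x hx => ?_⟩
    by_contra hxF
    exact hsub (hyz ▸ hx : f x ∈ PiNat.cylinder z n) ⟨x, hxF, rfl⟩
  set N : (ℕ → A) → ℕ := fun y => Nat.find (hex y)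
  have hle : ∀ y n y', y' ∈ PiNat.cylinder y n → N y ≤ n → N y' ≤ N y := by
    intro y n y' hy' hn
    have hy' := PiNat.cylinder_anti y hn hy'
    refine Nat.find_min' (hex y') ?_
    rw [PiNat.mem_cylinder_iff_eq.1 hy']
    exact Nat.find_spec (hex y)
  -- `N` is constant on the cylinder of length `N y` around `y`, so these cylinders form a partition.
  have hNeq : ∀ y, ∀ y' ∈ PiNat.cylinder y (N y), N y' = N y := by
    intro y y' hy'
    have h := hle y _ y' hy' le_rfl
    exact le_antisymm h (hle y' _ y ((PiNat.mem_cylinder_comm _ _ _).1 hy') h)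
  refine ⟨fun y => PiNat.cylinder y (N y), ?_, fun s => ?_⟩
  · rw [IsLocallyConstant.iff_exists_open]
    intro y
    refine ⟨_, PiNat.isOpen_cylinder _ y (N y), PiNat.self_mem_cylinder y _, fun y' hy' => ?_⟩
    rw [hNeq y y' hy', PiNat.mem_cylinder_iff_eq.1 hy']
  · by_cases h : ∃ y, PiNat.cylinder y (N y) = s
    · obtain ⟨y, rfl⟩ := h
      obtain ⟨F, hFω, hFfin, hF⟩ := Nat.find_spec (hex y)
      refine ⟨F, hFω, hFfin, fun x hx => hF ?_⟩
      have hx : PiNat.cylinder (f x) (N (f x)) = PiNat.cylinder y (N y) := hx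
      exact hx ▸ PiNat.self_mem_cylinder (f x) _
    · exact ⟨∅, empty_subset _, finite_empty, fun x hx => absurd ⟨f x, hx⟩ h⟩

/-- Over each part `s` of the partition, the traces on the preimage of `s` of the finitely many
sets covering it form a finite system `T s`. Systems over different parts do not meet, so the union
of all these systems is a finite-component covering. -/
theorem IsProperMap.isSuperparacompact {X : Type u} {A : Type*} [TopologicalSpace X]
    [TopologicalSpace A] [DiscreteTopology A] {f : X → ℕ → A} (hf : IsProperMap f) :
    IsSuperparacompact X := by
  rintro ω ⟨hopen, hcov⟩
  obtain ⟨c, hc, hF⟩ := hf.exists_isLocallyConstant_finite_cover hopen hcov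
  choose F hFω hFfin hF using hF
  set T : Set (ℕ → A) → Set (Set X) := fun s => (fun U => (c ∘ f) ⁻¹' {s} ∩ U) '' F s
  have hTfin : ∀ s, (T s).Finite := fun s => (hFfin s).image _
  have hTs : ∀ s, ∀ W ∈ T s, ∀ x ∈ W, c (f x) = s := by
    rintro s _ ⟨U, _, rfl⟩ x hx
    exact hx.1
  -- The empty set has to be left out: it would belong to several of the systems `T s`.
  set ω' : Set (Set X) := {W | W.Nonempty ∧ ∃ s, W ∈ T s}
  have hmeet : ∀ s, ∀ V ∈ T s, ∀ W ∈ ω', (V ∩ W).Nonempty → W ∈ T s := by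
    rintro s V hV W ⟨-, t, hW⟩ ⟨x, hxV, hxW⟩
    rwa [← hTs s V hV x hxV, hTs t W hW x hxW]
  refine ⟨ω', ⟨⟨?_, ?_⟩, ?_, ?_⟩, ?_⟩
  · rintro _ ⟨-, s, U, hU, rfl⟩
    exact ((hc.comp_continuous hf.continuous).isOpen_fiber s).inter (hopen U (hFω s hU))
  · refine eq_univ_of_forall fun x => ?_
    obtain ⟨U, hU, hxU⟩ := hF (c (f x)) (rfl : c (f x) = c (f x))
    exact ⟨(c ∘ f) ⁻¹' {c (f x)} ∩ U, ⟨⟨x, rfl, hxU⟩, c (f x), U, hU, rfl⟩, rfl, hxU⟩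
  · rintro V ⟨-, s, hV⟩
    exact (hTfin s).subset fun W hW => hmeet s V hV W hW.1 hW.2
  · intro σ hσ
    obtain rfl | ⟨V, hV⟩ := σ.eq_empty_or_nonempty
    · exact finite_empty
    obtain ⟨-, s, hVs⟩ := hσ.prop.1 hV
    refine (hTfin s).subset fun W hW => ?_
    have h := (chainConnected_iff_reflTransGen hV).1 (hσ.prop.2 V hV W hW)
    clear hW
    induction h with
    | refl => exact hVs
    | tail _ h ih => exact hmeet s _ ih _ (hσ.prop.1 h.2.1) h.2.2
  · rintro _ ⟨-, s, U, hU, rfl⟩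
    exact ⟨U, hFω s hU, inter_subset_right⟩

/-- On each part of a partition into clopen sets covered by finitely many `2⁻ⁿ`-balls, take the
distances to the centres of these balls. For varying `n` these functions separate the
points of each fibre of `f`. -/
theorem IsProperMap.exists_isClosedEmbedding_prod {X : Type*} {A : Type*} [TopologicalSpace X]
    [MetrizableSpace X] [TopologicalSpace A] [DiscreteTopology A] {f : X → ℕ → A}
    (hf : IsProperMap f) : ∃ g : X → (ℕ → A) × HilbertCube, IsClosedEmbedding g := by
  rcases isEmpty_or_nonempty X with hX | ⟨⟨x₀⟩⟩
  · exact ⟨isEmptyElim, .of_continuous_injective_isClosedMap (continuous_of_discreteTopology)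
      (fun x => isEmptyElim x) fun s _ => by simp [s.eq_empty_of_isEmpty]⟩
  let := metrizableSpaceMetric X
  have key : ∀ n : ℕ, ∃ (c : (ℕ → A) → Set (ℕ → A)) (p : Set (ℕ → A) → ℕ → X),
      IsLocallyConstant c ∧ ∀ x, ∃ i, dist x (p (c (f x)) i) < (1 / 2) ^ n := by
    intro n
    obtain ⟨c, hc, hF⟩ := hf.exists_isLocallyConstant_finite_cover
      (ω := range fun x => Metric.ball x ((1 / 2) ^ n))
      (by rintro _ ⟨x, rfl⟩; exact Metric.isOpen_ball)
      (eq_univ_of_forall fun x => ⟨Metric.ball x _, ⟨x, rfl⟩, Metric.mem_ball_self (by positivity)⟩)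
    have hp : ∀ s, ∃ p : ℕ → X, ∀ x, c (f x) = s → ∃ i, dist x (p i) < (1 / 2) ^ n := by
      intro s
      obtain ⟨F, hFω, hFfin, hF⟩ := hF s
      -- Adding one more ball makes the finite family of balls non-empty.
      obtain ⟨e, he⟩ := (hFfin.countable.insert (Metric.ball x₀ ((1 / 2) ^ n))).exists_eq_range
        (insert_nonempty _ _)
      have hp : ∀ k, ∃ p, Metric.ball p ((1 / 2) ^ n) = e k := fun k => by
        have hk : e k ∈ insert (Metric.ball x₀ ((1 / 2) ^ n)) F := he ▸ mem_range_self k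
        exact insert_subset (mem_range_self x₀) hFω hk
      choose p hp using hp
      refine ⟨p, fun x hx => ?_⟩
      obtain ⟨V, hV, hxV⟩ := hF hx
      obtain ⟨k, rfl⟩ : V ∈ range e := he ▸ mem_insert_of_mem _ hV
      exact ⟨k, by rwa [← hp k] at hxV⟩
    choose p hp using hp
    exact ⟨c, p, hc, fun x => hp _ x rfl⟩
  choose c p hc hp using key
  set h : X → HilbertCube := fun x k =>
    projIcc 0 1 zero_le_one (dist x (p k.unpair.1 (c k.unpair.1 (f x)) k.unpair.2)) with hh
  have hcont : Continuous h := by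
    refine continuous_pi fun k => continuous_projIcc.comp (continuous_iff_continuousAt.2 fun x => ?_)
    have hev := (IsLocallyConstant.iff_eventually_eq _).1
      ((hc k.unpair.1).comp_continuous hf.continuous) x
    refine ContinuousAt.congr (f := fun y => dist y (p k.unpair.1 (c k.unpair.1 (f x)) k.unpair.2))
      (by fun_prop) ?_
    filter_upwards [hev] with y hy
    simp only [Function.comp] at hy
    rw [hy]
  have hg : IsProperMap fun x => (f x, h x) :=
    isProperMap_of_comp_of_t2 (hf.continuous.prodMk hcont) continuous_fst hf
  refine ⟨_, .of_continuous_injective_isClosedMap hg.continuous ?_ hg.isClosedMap⟩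
  intro x y hxy
  obtain ⟨hfxy, hhxy⟩ := Prod.ext_iff.1 hxy
  by_contra hne
  obtain ⟨n, hn⟩ := exists_pow_lt_of_lt_one (half_pos (dist_pos.2 hne))
    (by norm_num : (1 / 2 : ℝ) < 1)
  -- Pass to exponent `n + 1` so that the distance is below `1`, where truncation is harmless.
  obtain ⟨i, hi⟩ := hp (n + 1) x
  have h1 : (1 / 2 : ℝ) ^ (n + 1) < 1 := pow_lt_one₀ (by norm_num) (by norm_num) (by omega)
  have h2 : (1 / 2 : ℝ) ^ (n + 1) ≤ (1 / 2) ^ n :=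
    pow_le_pow_of_le_one (by norm_num) (by norm_num) (by omega)
  have h3 := congrArg Subtype.val (congrFun hhxy (Nat.pair (n + 1) i))
  simp only [hh, Nat.unpair_pair, coe_projIcc] at h3
  rw [← show f x = f y from hfxy] at h3
  rw [min_eq_right (hi.trans h1).le, max_eq_right dist_nonneg,
    max_eq_right (le_min zero_le_one dist_nonneg)] at h3
  have h4 := dist_triangle_right x y (p (n + 1) (c (n + 1) (f x)) i)
  have h5 : dist y (p (n + 1) (c (n + 1) (f x)) i) < (1 / 2) ^ (n + 1) := by
    rw [h3] at hi
    exact (min_lt_iff.1 hi).resolve_left h1.not_gt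
  linarith

/-! ### Weight of subspaces -/

/-- The sets given by a finite word in `A` and a member of a countable base of `Y` form a base of
`(ℕ → A) × Y`; there are at most `#(List A × ℕ) = #A` of them. -/
theorem topWeight_le_of_isInducing {X A : Type u} {Y : Type*} [TopologicalSpace X]
    [TopologicalSpace A] [DiscreteTopology A] [Infinite A] [TopologicalSpace Y]
    [SecondCountableTopology Y] {g : X → (ℕ → A) × Y} (hg : IsInducing g) : topWeight X ≤ #A := by
  obtain ⟨e, he⟩ := countable_iff_exists_subset_range.1 (countable_countableBasis Y)
  have hb := ((PiNat.isTopologicalBasis_cylinders fun _ : ℕ => A).prod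
    (isBasis_countableBasis Y)).isInducing hg
  have hle : topWeight X ≤ _ := csInf_le' ⟨_, hb, rfl⟩
  refine hle.trans ?_
  have hsub : (preimage g '' image2 (· ×ˢ ·)
      {s : Set (ℕ → A) | ∃ x n, s = PiNat.cylinder x n} (countableBasis Y)) ⊆
      range fun q : List A × ℕ =>
        g ⁻¹' ({y | PiNat.res y q.1.length = q.1} ×ˢ e q.2) := by
    rintro _ ⟨_, ⟨_, ⟨x, n, rfl⟩, V, hV, rfl⟩, rfl⟩
    obtain ⟨k, rfl⟩ := he hV
    exact ⟨(PiNat.res x n, k), by simp [PiNat.cylinder_eq_res]⟩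
  refine (Cardinal.mk_le_mk_of_subset hsub).trans (Cardinal.mk_range_le.trans ?_)
  simp [Cardinal.mk_list_eq_mk]

/-! ### The equivalence -/

theorem tfae_isSuperparacompact_isProperMap_isClosedEmbedding (X A : Type u) [TopologicalSpace X]
    [MetrizableSpace X] [TopologicalSpace A] [DiscreteTopology A] [Infinite A] :
    List.TFAE
      [IsSuperparacompact X ∧ IsCompletelyMetrizableSpace X ∧ topWeight X ≤ #A,
       ∃ f : X → ℕ → A, IsProperMap f,
       ∃ g : X → (ℕ → A) × HilbertCube, IsClosedEmbedding g] := by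
  tfae_have 1 → 2 := fun ⟨h, _, hA⟩ => exists_isProperMap_of_isSuperparacompact h hA
  tfae_have 2 → 3 := fun ⟨_, hf⟩ => hf.exists_isClosedEmbedding_prod
  tfae_have 3 → 1 := by
    rintro ⟨g, hg⟩
    have hf : IsProperMap (Prod.fst ∘ g) := isProperMap_fst_of_compactSpace.comp hg.isProperMap
    exact ⟨hf.isSuperparacompact, hg.IsCompletelyMetrizableSpace,
      topWeight_le_of_isInducing hg.isInducing⟩
  tfae_finish

/-- Perfect maps (continuous closed maps with compact fibres) are Mathlib's `IsProperMap`,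
see `isProperMap_iff_isClosedMap_and_compact_fibers`. -/
theorem theorem2 (X : Type u) [TopologicalSpace X] [MetrizableSpace X]
    (τ : Cardinal.{u}) (hτ : ℵ₀ ≤ τ) :
    List.TFAE
      [IsSuperparacompact X ∧ IsCompletelyMetrizableSpace X ∧ topWeight X ≤ τ,
       ∃ f : X → GenBaireSpace τ, IsProperMap f,
       ∃ g : X → GenBaireSpace τ × HilbertCube, IsClosedEmbedding g] := by
  let : TopologicalSpace τ.out := ⊥
  have : DiscreteTopology τ.out := ⟨rfl⟩
  have : Infinite τ.out := by rwa [Cardinal.infinite_iff, Cardinal.mk_out]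
  have h := tfae_isSuperparacompact_isProperMap_isClosedEmbedding X τ.out
  rw [Cardinal.mk_out] at h
  exact h
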